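/- **Setting.** Let $\mathbb G=([n],\mathbb E)$ be an undirected graph. For $x\in\mathbb R^n$ and $S\subseteq[n]$ let $x_S$ be the vector that agrees with $x$ on $S$ and vanishes off $S$; write $\nabla_S f(x)=(\nabla f(x))_S$ and $\|\cdot\|$ for the Euclidean norm. Let $\mathbb M(k,g)$ be the family of all $S\subseteq[n]$ with $|S|\le k$ whose induced subgraph has at most $g$ connected components. *SRL.* For differentiable $f:\mathbb R^n\to\mathbb R$ put $B_f(x\|y)=f(x)-f(y)-\langle\nabla f(y),x-y\rangle$, and let $\alpha_s(x)$ and $\beta_s(x)$ be the supremum and the infimum of $B_f(x+y\,\|\,x)/\|y\|^2$ over all $y\ne0$ with $|\mathrm{supp}(x)\cup\mathrm{supp}(y)|\le s$. Then $f$ is $\mu$-SRL at level $s$ if $\alpha_s(x)/\beta_s(x)\le\mu$ for all $x$ with $|\mathrm{supp}(x)|\le s$. *Subroutines.* With $c_H=\sqrt{1/14}$ and $c_T=\sqrt7$: a head approximation returns, for each $v\in\mathbb R^n$, a set $H(v)\in\mathbb M(2k,g)$ with $\|v_{H(v)}\|\ge c_H\max_{S\in\mathbb M(k,g)}\|v_S\|$;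 a tail approximation returns a set $T(v)\in\mathbb M(5k,g)$ with $\|v-v_{T(v)}\|\le c_T\min_{S\in\mathbb M(k,g)}\|v-v_S\|$. *Graph-MP.* Start from $x^0=0$ and iterate: $\Gamma=H(\nabla f(x^i))$; $\Omega=\Gamma\cup\mathrm{supp}(x^i)$; $b\in\arg\min\{f(z): z_{\Omega^c}=0\}$; $B=T(b)$; $x^{i+1}=b_B$. After the prescribed number $N\ge1$ of iterations return $\hat x=x^N$. **Theorem.** Let $f:\mathbb R^n\to\mathbb R$ be differentiable and $\mu$-SRL at level $8k$ with $\mu\le1+\sqrt{1/56}$, and suppose that for some $\varepsilon>0$, $\beta_{8k}(z)\ge\varepsilon$ for all $z$ with $|\mathrm{supp}(z)|\le 8k$. Put $$\sigma=\sqrt{\mu^2-(2+c_H-2\mu)^2},\qquad \nu=\frac{(2+c_H-2\mu)(1+c_H)+\sigma}{2\varepsilon\sigma},$$ and assume $\sigma<1$. Let $x\in\mathbb R^n$ be such that $\mathrm{supp}(x)$ is contained in a member of $\mathbb M(k,g)$, let $I\in\arg\max_{S\in\mathbb M(8k,g)}\|\nabla_S f(x)\|$, and assume $\nabla_I f(x)\neq0$.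 Let $$N_0=\max\Big\{1,\Big\lceil \log\frac{\|x\|}{\|\nabla_I f(x)\|}\Big/\log\frac1\sigma\Big\rceil\Big\}.$$ 1. *Accuracy.* For every head approximation and every tail approximation and every $N\ge N_0$, the vector $\hat x$ that Graph-MP returns after $N$ iterations is supported in a member of $\mathbb M(5k,g)$ and $$\|x-\hat x\|\le\Big(1+\frac{\nu}{1-\sigma}\Big)\|\nabla_I f(x)\|.$$ 2. *Running time.* Suppose that one execution of the subproblem defining $b$, for $|\Omega|\le7k$, takes at most $T$ steps; that each call of the head and of the tail approximation takes at most $C_0|\mathbb E|\log^3 n$ steps; and that one gradient evaluation takes at most $C_0(T+|\mathbb E|\log^3 n)$ steps, a quantity that is also at least $n+1$ (the cost of a pass over a vector). Then Graph-MP, stopped after $N_0$ iterations, takes at most $$C\,\big(T+|\mathbb E|\log^3 n\big)\,\max\Big\{1,\log\frac{\|x\|}{\|\nabla_I f(x)\|}\Big\}$$ steps, where $C$ depends only on $\mu$ and $C_0$. In particular, if $T\le an$ and $|\mathbb E|\le an$, the number of steps is at most $C\,a\,n(1+\log^3 n)\max\{1,\log(\|x\|/\|\nabla_I f(x)\|)\}$.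 -/

import Mathlib

open scoped RealInnerProductSpace Gradient

noncomputable section

namespace GraphMP

/-! ### Vectors, supports, restrictions -/

/-- `ℝⁿ` with the Euclidean norm. -/
abbrev Vec (n : ℕ) : Type := EuclideanSpace ℝ (Fin n)

open Classical in
/-- The support of a vector. -/
def supp {n : ℕ} (x : Vec n) : Finset (Fin n) := Finset.univ.filter fun i => x i ≠ 0

/-- `x_S`: the vector that agrees with `x` on `S` and vanishes off `S`. -/
def restrict {n : ℕ} (x : Vec n) (S : Finset (Fin n)) : Vec n :=
  WithLp.toLp 2 fun i => if i ∈ S then x i else 0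

/-! ### The graph-structured sparsity model -/

/-- `γ(S)`: the number of connected components of the subgraph induced by `S`. -/
def numComponents {n : ℕ} (G : SimpleGraph (Fin n)) (S : Finset (Fin n)) : ℕ :=
  Nat.card (G.induce (S : Set (Fin n))).ConnectedComponent

/-- `𝕄(k, g)`: node sets with at most `k` nodes that induce at most `g` connected components. -/
def model {n : ℕ} (G : SimpleGraph (Fin n)) (k g : ℕ) : Set (Finset (Fin n)) :=
  {S | S.card ≤ k ∧ numComponents G S ≤ g}

/-- The vector `x` obeys the sparsity model: its support lies in a member of `𝕄(k, g)`. -/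
def ObeysModel {n : ℕ} (G : SimpleGraph (Fin n)) (k g : ℕ) (x : Vec n) : Prop :=
  ∃ S ∈ model G k g, supp x ⊆ S

/-- `I ∈ argmax {‖v_S‖ : S ∈ 𝕄(k, g)}`. -/
def IsArgmaxOver {n : ℕ} (G : SimpleGraph (Fin n)) (k g : ℕ) (v : Vec n)
    (I : Finset (Fin n)) : Prop :=
  I ∈ model G k g ∧ ∀ S ∈ model G k g, ‖restrict v S‖ ≤ ‖restrict v I‖

/-! ### Stable restricted linearization -/

/-- The Bregman divergence `B_f(x ‖ y) = f x - f y - ⟨∇ f(y), x - y⟩`. -/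
def bregman {n : ℕ} (f : Vec n → ℝ) (x y : Vec n) : ℝ :=
  f x - f y - ⟪∇ f y, x - y⟫

/-- The directions `y ≠ 0` with `|supp x ∪ supp y| ≤ s`. -/
def directions {n : ℕ} (s : ℕ) (x : Vec n) : Set (Vec n) :=
  {y | y ≠ 0 ∧ (supp x ∪ supp y).card ≤ s}

/-- `α_s(x)`, a supremum in `[-∞, ∞]`. -/
def srlAlpha {n : ℕ} (f : Vec n → ℝ) (s : ℕ) (x : Vec n) : EReal :=
  ⨆ y ∈ directions s x, ((1 / ‖y‖ ^ 2 * bregman f (x + y) x : ℝ) : EReal)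

/-- `β_s(x)`, an infimum in `[-∞, ∞]`. -/
def srlBeta {n : ℕ} (f : Vec n → ℝ) (s : ℕ) (x : Vec n) : EReal :=
  ⨅ y ∈ directions s x, ((1 / ‖y‖ ^ 2 * bregman f (x + y) x : ℝ) : EReal)

/-- `f` has a stable restricted linearization with constant `μ` at sparsity level `s`. -/
def IsSRL {n : ℕ} (f : Vec n → ℝ) (s : ℕ) (μ : ℝ) : Prop :=
  ∀ x : Vec n, (supp x).card ≤ s → srlAlpha f s x / srlBeta f s x ≤ (μ : EReal)

/-! ### Approximation constants and the parameters `σ`, `ν` -/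

/-- `c_H = √(1/14)`. -/
def cHead : ℝ := √(1 / 14)

/-- `c_T = √7`. -/
def cTail : ℝ := √7

/-- `σ = √(μ² - (2 + c_H - 2μ)²)`. -/
def sigma (μ : ℝ) : ℝ := √(μ ^ 2 - (2 + cHead - 2 * μ) ^ 2)

/-- `ν = ((2 + c_H - 2μ)(1 + c_H) + σ) / (2 ε σ)`. -/
def nu (μ ε : ℝ) : ℝ :=
  ((2 + cHead - 2 * μ) * (1 + cHead) + sigma μ) / (2 * ε * sigma μ)

/-! ### Step-counted computations -/

/-- A computation: the value that it returns and the number of elementary steps that it takes. -/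
structure Timed (α : Type) where
  val : α
  cost : ℕ

/-- Return `a` after `c` elementary steps. -/
def charge {α : Type} (c : ℕ) (a : α) : Timed α := ⟨a, c⟩

/-- Sequential composition adds up the steps. -/
instance : Monad Timed where
  pure a := ⟨a, 0⟩
  bind m h := ⟨(h m.val).val, m.cost + (h m.val).cost⟩

/-- The subroutines that Graph-MP calls: evaluation of the gradient (line 3), head
approximation (line 4), the solver of the subproblem (line 6), tail approximation (line 7). -/
structure Subroutines (n : ℕ) where
  grad : Vec n → Timed (Vec n)
  head : Vec n → Timed (Finset (Fin n))
  solve : Finset (Fin n) → Timed (Vec n)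
  tail : Vec n → Timed (Finset (Fin n))

/-- `b ∈ argmin {f z : z_{Ωᶜ} = 0}`. -/
def IsArgmin {n : ℕ} (f : Vec n → ℝ) (Ω : Finset (Fin n)) (b : Vec n) : Prop :=
  supp b ⊆ Ω ∧ ∀ z : Vec n, supp z ⊆ Ω → f b ≤ f z

/-- `Γ` is a valid output `H(v)` of head approximation. -/
def IsHeadApprox {n : ℕ} (G : SimpleGraph (Fin n)) (k g : ℕ) (v : Vec n)
    (Γ : Finset (Fin n)) : Prop :=
  Γ ∈ model G (2 * k) g ∧ ∀ S ∈ model G k g, cHead * ‖restrict v S‖ ≤ ‖restrict v Γ‖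

/-- `B` is a valid output `T(v)` of tail approximation. -/
def IsTailApprox {n : ℕ} (G : SimpleGraph (Fin n)) (k g : ℕ) (v : Vec n)
    (B : Finset (Fin n)) : Prop :=
  B ∈ model G (5 * k) g ∧
    ∀ S ∈ model G k g, ‖v - restrict v B‖ ≤ cTail * ‖v - restrict v S‖

/-- The subroutines return what they are specified to return. The solver is only asked to return
a minimizer where there is one. -/
structure Subroutines.Correct {n : ℕ} (R : Subroutines n) (G : SimpleGraph (Fin n)) (k g : ℕ)
    (f : Vec n → ℝ) : Prop where
  grad : ∀ z, (R.grad z).val = ∇ f z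
  head : ∀ v, IsHeadApprox G k g v (R.head v).val
  solve : ∀ Ω, (∃ b, IsArgmin f Ω b) → IsArgmin f Ω (R.solve Ω).val
  tail : ∀ v, IsTailApprox G k g v (R.tail v).val

/-- `|𝔼| · log³ n`. -/
def edgeLogCube {n : ℕ} (G : SimpleGraph (Fin n)) : ℝ :=
  (G.edgeSet.ncard : ℝ) * Real.log n ^ 3

/-- Running times of the subroutines: one execution of the subproblem (on a set of at most `7k`
nodes, the largest that can occur) takes at most `T` steps; head and tail approximation
take `O(|𝔼| log³ n)` steps; one gradient evaluation, and one pass over a vector of length `n`,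
take `O(T + |𝔼| log³ n)` steps. The constant in each `O` is `C₀`. -/
structure Subroutines.Within {n : ℕ} (R : Subroutines n) (G : SimpleGraph (Fin n)) (k : ℕ)
    (C₀ T : ℝ) : Prop where
  solve : ∀ Ω, Ω.card ≤ 7 * k → ((R.solve Ω).cost : ℝ) ≤ T
  head : ∀ v, ((R.head v).cost : ℝ) ≤ C₀ * edgeLogCube G
  tail : ∀ v, ((R.tail v).cost : ℝ) ≤ C₀ * edgeLogCube G
  grad : ∀ z, ((R.grad z).cost : ℝ) ≤ C₀ * (T + edgeLogCube G)
  pass : (n : ℝ) + 1 ≤ C₀ * (T + edgeLogCube G)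

/-! ### The algorithm -/

/-- One iteration (lines 3 to 8). Forming `Γ ∪ supp x`, and forming `b_B`, is a pass over the
coordinates; the final `1` pays for the test of the halting condition. -/
def iteration {n : ℕ} (R : Subroutines n) (x : Vec n) : Timed (Vec n) := do
  let v ← R.grad x
  let Γ ← R.head v
  let Ω ← charge n (Γ ∪ supp x)
  let b ← R.solve Ω
  let B ← R.tail b
  charge (n + 1) (restrict b B)

/-- The loop, halted after `N` iterations. -/
def loop {n : ℕ} (R : Subroutines n) : ℕ → Vec n → Timed (Vec n)
  | 0, x => pure x
  | N + 1, x => do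
    let x' ← iteration R x
    loop R N x'

/-- Graph-MP, halted after `N` iterations; writing down `x⁰ = 0` takes `n` steps. -/
def graphMP {n : ℕ} (R : Subroutines n) (N : ℕ) : Timed (Vec n) := do
  let x₀ ← charge n (0 : Vec n)
  loop R N x₀

/-- The number of iterations: `⌈log (a / b) / log (1 / σ)⌉`, but at least one, as the
halting condition is tested at the end of an iteration. -/
def numIterations (σ a b : ℝ) : ℕ := max 1 ⌈Real.log (a / b) / Real.log (1 / σ)⌉₊

end GraphMP

end

open scoped RealInnerProductSpace Gradient

/-!
The proof follows the error `r = xⁱ - x` through one iteration of Graph-MP and shows that it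
contracts by `σ` until it reaches a noise floor that is proportional to `‖∇_I f(x)‖ / (2 * ε)`.

*The gradient is nearly linear on small coordinate subspaces.* The SRL constants `α(z)`, `β(z)`
may vary with the base point `z`, but along a common ray both describe the quadratic growth of `f`
at infinity, so `β(z) ≤ α(z')` for all `z`, `z'` in a coordinate subspace of dimension at most `8k`
(`lower_le_upper`). Together with `α ≤ μ * β` this bounds all Bregman divergences in the subspace
between `m * ‖·‖ ^ 2` and `M * ‖·‖ ^ 2` with `M ≤ μ ^ 2 * m` (`exists_uniform_bounds`).
By polarization (`norm_gradient_sub_le`) the restricted gradient is then `c = M + m` times the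
identity up to a relative error of about `τ = (μ ^ 2 - 1) / 2`, and `c ≥ 2 * ε`
(`exists_gradient_nearly_linear`). The same bounds give the existence of the minimizer `b` and
the vanishing of its partial gradient on `Ω`.

*One iteration.* Let `Φ` be a member of `𝕄(k, g)` that contains the support of `x`. Head
approximation of the gradient captures, up to noise and nonlinearity, a fraction `c_H` of `r_Φ`
(`head_captures`), and `r` is concentrated on `Φ`, an invariant of the iteration. Hence
`‖x_{Ωᶜ}‖` is at most about `√(1 - c_H ^ 2) * ‖r‖`. On `Ω` the minimizer differs from `x` only by noise
and nonlinearity (`norm_restrict_minimizer_sub_le`). What tail approximation discards is supported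
in `Ω`, hence orthogonal to `x_{Ωᶜ}`, so that the factor `1 + c_T` multiplies only this small part
(`norm_restrict_tail_sub_sq_le`) and does not spoil the contraction.

*Constants.* The estimates combine to a quadratic recursion for `‖r‖`. The SRL condition forces `1 ≤ μ`,
the condition `σ < 1` forces `μ < 1.024`, and in this range `σ` is a rate for the recursion and `ν / (1 - σ)` a
supersolution of it (`contraction_of_step_estimates`). After `N₀` iterations the geometric part
`σ ^ N * ‖x‖` is below `‖∇_I f(x)‖`. The running time is `N₀` times the cost of one iteration, where
`N₀` is at most a constant times `max 1 (log (‖x‖ / ‖∇_I f(x)‖))` because `0 < σ < 1`.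
-/

open scoped RealInnerProductSpace Gradient

namespace GraphMP

variable {n : ℕ}

/-! ### Restrictions and supports -/

@[simp]
lemma restrict_apply (x : Vec n) (S : Finset (Fin n)) (i : Fin n) :
    restrict x S i = if i ∈ S then x i else 0 := rfl

lemma mem_supp {x : Vec n} {i : Fin n} : i ∈ supp x ↔ x i ≠ 0 := by
  simp [supp]

lemma supp_subset_iff {x : Vec n} {S : Finset (Fin n)} :
    supp x ⊆ S ↔ ∀ i, i ∉ S → x i = 0 := by
  constructor
  · intro h i hi
    by_contra hx
    exact hi (h (mem_supp.2 hx))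
  · intro h i hi
    by_contra hS
    exact mem_supp.1 hi (h i hS)

@[simp]
lemma supp_zero : supp (0 : Vec n) = ∅ := by
  simp [supp]

lemma supp_restrict_subset (x : Vec n) (S : Finset (Fin n)) : supp (restrict x S) ⊆ S :=
  supp_subset_iff.2 fun i hi => by simp [hi]

lemma supp_add_subset {x y : Vec n} {S : Finset (Fin n)} (hx : supp x ⊆ S) (hy : supp y ⊆ S) :
    supp (x + y) ⊆ S := by
  rw [supp_subset_iff] at *
  intro i hi
  simp [hx i hi, hy i hi]

lemma supp_sub_subset {x y : Vec n} {S : Finset (Fin n)} (hx : supp x ⊆ S) (hy : supp y ⊆ S) :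
    supp (x - y) ⊆ S := by
  rw [supp_subset_iff] at *
  intro i hi
  simp [hx i hi, hy i hi]

lemma supp_smul_subset {x : Vec n} {S : Finset (Fin n)} (t : ℝ) (hx : supp x ⊆ S) :
    supp (t • x) ⊆ S := by
  rw [supp_subset_iff] at *
  intro i hi
  simp [hx i hi]

lemma restrict_sub (x y : Vec n) (S : Finset (Fin n)) :
    restrict (x - y) S = restrict x S - restrict y S := by
  ext i
  by_cases hi : i ∈ S <;> simp [hi]

lemma restrict_smul (t : ℝ) (x : Vec n) (S : Finset (Fin n)) :
    restrict (t • x) S = t • restrict x S := by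
  ext i
  by_cases hi : i ∈ S <;> simp [hi]

lemma restrict_restrict_of_subset (x : Vec n) {S F : Finset (Fin n)} (h : S ⊆ F) :
    restrict (restrict x F) S = restrict x S := by
  ext i
  by_cases hi : i ∈ S
  · simp [hi, h hi]
  · simp [hi]

lemma norm_sq_eq_sum (x : Vec n) : ‖x‖ ^ 2 = ∑ i, x i ^ 2 := by
  simp [EuclideanSpace.norm_sq_eq]

lemma norm_restrict_sq (x : Vec n) (S : Finset (Fin n)) :
    ‖restrict x S‖ ^ 2 = ∑ i ∈ S, x i ^ 2 := by
  rw [norm_sq_eq_sum]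
  simp [ite_pow]

lemma norm_sq_eq_restrict_add_compl (x : Vec n) (S : Finset (Fin n)) :
    ‖x‖ ^ 2 = ‖restrict x S‖ ^ 2 + ‖restrict x Sᶜ‖ ^ 2 := by
  rw [norm_restrict_sq, norm_restrict_sq, norm_sq_eq_sum, Finset.sum_add_sum_compl]

lemma norm_restrict_mono (x : Vec n) {S S' : Finset (Fin n)} (h : S ⊆ S') :
    ‖restrict x S‖ ≤ ‖restrict x S'‖ := by
  refine le_of_sq_le_sq ?_ (norm_nonneg _)
  rw [norm_restrict_sq, norm_restrict_sq]
  exact Finset.sum_le_sum_of_subset_of_nonneg h fun i _ _ => sq_nonneg _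

lemma norm_restrict_le (x : Vec n) (S : Finset (Fin n)) : ‖restrict x S‖ ≤ ‖x‖ := by
  refine le_of_sq_le_sq ?_ (norm_nonneg _)
  rw [norm_sq_eq_restrict_add_compl x S]
  nlinarith [sq_nonneg ‖restrict x Sᶜ‖]

lemma norm_le_restrict_add_compl (x : Vec n) (S : Finset (Fin n)) :
    ‖x‖ ≤ ‖restrict x S‖ + ‖restrict x Sᶜ‖ := by
  refine le_of_sq_le_sq ?_ (by positivity)
  rw [norm_sq_eq_restrict_add_compl x S]
  nlinarith [mul_nonneg (norm_nonneg (restrict x S)) (norm_nonneg (restrict x Sᶜ))]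

lemma norm_restrict_union_sq_le (x : Vec n) (S S' : Finset (Fin n)) :
    ‖restrict x (S ∪ S')‖ ^ 2 ≤ ‖restrict x S‖ ^ 2 + ‖restrict x S'‖ ^ 2 := by
  rw [norm_restrict_sq, norm_restrict_sq, norm_restrict_sq, ← Finset.sum_union_inter]
  exact le_add_of_nonneg_right (Finset.sum_nonneg fun i _ => sq_nonneg _)

lemma inner_restrict_left {w : Vec n} {S : Finset (Fin n)} (v : Vec n) (hw : supp w ⊆ S) :
    ⟪restrict v S, w⟫ = ⟪v, w⟫ := by
  simp only [PiLp.inner_apply]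
  refine Finset.sum_congr rfl fun i _ => ?_
  by_cases hi : i ∈ S
  · simp [hi]
  · simp [hi, supp_subset_iff.1 hw i hi]

/-! ### Consequences of stable restricted linearization -/

/-- Real-valued form of stable restricted linearization: at each sparse point one number `b`
bounds the Bregman divergence from below, and `μ * b` bounds it from above. -/
lemma IsSRL.exists_bounds {f : Vec n → ℝ} {s : ℕ} {μ ε : ℝ} (hf : IsSRL f s μ) (hε : 0 < ε)
    {z : Vec n} (hz : (supp z).card ≤ s) (hβ : (ε : EReal) ≤ srlBeta f s z) :
    ∃ b, ε ≤ b ∧ ∀ y : Vec n, (supp z ∪ supp y).card ≤ s →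
      b * ‖y‖ ^ 2 ≤ bregman f (z + y) z ∧ bregman f (z + y) z ≤ μ * b * ‖y‖ ^ 2 := by
  have hα := hf z hz
  have lower : ∀ y ∈ directions s z,
      srlBeta f s z ≤ ((1 / ‖y‖ ^ 2 * bregman f (z + y) z : ℝ) : EReal) :=
    fun y hy => iInf₂_le y hy
  have upper : ∀ y ∈ directions s z,
      ((1 / ‖y‖ ^ 2 * bregman f (z + y) z : ℝ) : EReal) ≤ srlAlpha f s z :=
    fun y hy => le_iSup₂ (f := fun y (_ : y ∈ directions s z) =>
      ((1 / ‖y‖ ^ 2 * bregman f (z + y) z : ℝ) : EReal)) y hy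
  generalize srlBeta f s z = β at *
  generalize srlAlpha f s z = α at *
  have hzero : bregman f z z = 0 := by simp [bregman]
  induction β with
  | bot => simp at hβ
  | top =>
    -- The infimum is `⊤` only when there is no admissible direction.
    refine ⟨ε, le_rfl, fun y hy => ?_⟩
    by_cases h0 : y = 0
    · subst h0; simp [hzero]
    · exact absurd (lower y ⟨h0, hy⟩) (not_le.2 (EReal.coe_lt_top _))
  | coe b =>
    have hb : ε ≤ b := by exact_mod_cast hβ
    have hb0 : 0 < b := hε.trans_le hb
    rw [EReal.div_le_iff_le_mul (by exact_mod_cast hb0) (EReal.coe_ne_top b)] at hα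
    refine ⟨b, hb, fun y hy => ?_⟩
    by_cases h0 : y = 0
    · subst h0; simp [hzero]
    · have hy2 : 0 < ‖y‖ ^ 2 := by positivity
      have h1 := lower y ⟨h0, hy⟩
      have h2 := (upper y ⟨h0, hy⟩).trans hα
      rw [← EReal.coe_mul] at h2
      have h1' : b ≤ 1 / ‖y‖ ^ 2 * bregman f (z + y) z := by exact_mod_cast h1
      have h2' : 1 / ‖y‖ ^ 2 * bregman f (z + y) z ≤ b * μ := by exact_mod_cast h2
      rw [one_div_mul_eq_div] at h1' h2'
      rw [le_div_iff₀ hy2] at h1'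
      rw [div_le_iff₀ hy2] at h2'
      exact ⟨h1', by linarith⟩

/-- A real polynomial of degree at most two which is nonnegative on `(0, ∞)` has nonnegative
leading coefficient. -/
lemma nonneg_of_quadratic_nonneg {a b c : ℝ} (h : ∀ t : ℝ, 0 < t → 0 ≤ a * t ^ 2 + b * t + c) :
    0 ≤ a := by
  by_contra! ha
  set t := 1 + (|b| + |c|) / -a with ht
  have hq : 0 ≤ (|b| + |c|) / -a := div_nonneg (by positivity) (by linarith)
  have ht1 : 1 ≤ t := by linarith
  have h1 := h t (by linarith)
  have h2 : -a * t = -a + (|b| + |c|) := by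
    rw [ht]; field_simp [ha.ne]; ring
  have h3 := le_abs_self b
  have h4 := le_abs_self c
  have h5 : 0 ≤ |c| * (t - 1) := mul_nonneg (abs_nonneg c) (by linarith)
  nlinarith [mul_le_mul_of_nonneg_right h3 (by linarith : (0:ℝ) ≤ t)]

/-- The lower linearization constant at `z` is at most the upper one at `z'`: both control the
quadratic growth of `f` at infinity along a common ray. -/
lemma lower_le_upper {f : Vec n → ℝ} {F : Finset (Fin n)} {z z' y : Vec n} {b a : ℝ}
    (hz : supp z ⊆ F) (hz' : supp z' ⊆ F) (hy : supp y ⊆ F) (hy0 : y ≠ 0)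
    (hb : ∀ w, supp w ⊆ F → b * ‖w‖ ^ 2 ≤ bregman f (z + w) z)
    (ha : ∀ w, supp w ⊆ F → bregman f (z' + w) z' ≤ a * ‖w‖ ^ 2) : b ≤ a := by
  have hy2 : 0 < ‖y‖ ^ 2 := by positivity
  have key : 0 ≤ (a - b) * ‖y‖ ^ 2 := by
    refine nonneg_of_quadratic_nonneg
      (b := a * (2 * ⟪z - z', y⟫) + ⟪∇ f z', y⟫ - ⟪∇ f z, y⟫)
      (c := a * ‖z - z'‖ ^ 2 + f z' + ⟪∇ f z', z - z'⟫ - f z) fun t _ => ?_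
    have h1 := hb (t • y) (supp_smul_subset t hy)
    have h2 := ha (z - z' + t • y)
      (supp_add_subset (supp_sub_subset hz hz') (supp_smul_subset t hy))
    have e : z' + (z - z' + t • y) = z + t • y := by abel
    rw [e] at h2
    have e1 : z + t • y - z = t • y := by abel
    have e2 : z + t • y - z' = z - z' + t • y := by abel
    simp only [bregman, e1, e2, inner_add_right, inner_smul_right, norm_smul, mul_pow,
      Real.norm_eq_abs, sq_abs, norm_add_sq_real] at h1 h2
    nlinarith
  nlinarith

/-- On a coordinate subspace of admissible dimension one pair of constants, of ratio at most
`μ ^ 2`, bounds the Bregman divergence uniformly in the base point. -/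
lemma exists_uniform_bounds {f : Vec n → ℝ} {s : ℕ} {μ ε : ℝ} (hf : IsSRL f s μ) (hμ : 1 ≤ μ)
    (hε : 0 < ε) (hβ : ∀ z : Vec n, (supp z).card ≤ s → (ε : EReal) ≤ srlBeta f s z)
    {F : Finset (Fin n)} (hF : F.card ≤ s) :
    ∃ β, ε ≤ β ∧ ∀ u v : Vec n, supp u ⊆ F → supp v ⊆ F →
      β / μ * ‖u - v‖ ^ 2 ≤ bregman f u v ∧ bregman f u v ≤ μ * β * ‖u - v‖ ^ 2 := by
  have hμ0 : 0 < μ := by linarith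
  have hex : ∀ z : Vec n, ∃ b, ε ≤ b ∧ (supp z ⊆ F → ∀ y : Vec n, supp y ⊆ F →
      b * ‖y‖ ^ 2 ≤ bregman f (z + y) z ∧ bregman f (z + y) z ≤ μ * b * ‖y‖ ^ 2) := by
    intro z
    by_cases hz : supp z ⊆ F
    · have hc := (Finset.card_le_card hz).trans hF
      obtain ⟨b, hb, h⟩ := hf.exists_bounds hε hc (hβ z hc)
      exact ⟨b, hb, fun _ y hy =>
        h y ((Finset.card_le_card (Finset.union_subset hz hy)).trans hF)⟩
    · exact ⟨ε, le_rfl, fun h => absurd h hz⟩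
  choose b hbε hb using hex
  by_cases hy : ∃ y : Vec n, supp y ⊆ F ∧ y ≠ 0
  · obtain ⟨y, hyF, hy0⟩ := hy
    have cross : ∀ z z' : Vec n, supp z ⊆ F → supp z' ⊆ F → b z ≤ μ * b z' :=
      fun z z' hz hz' => lower_le_upper hz hz' hyF hy0 (fun w hw => (hb z hz w hw).1)
        fun w hw => (hb z' hz' w hw).2
    have h0 : supp (0 : Vec n) ⊆ F := by simp
    set A : Set ℝ := b '' {z | supp z ⊆ F} with hA
    have hne : A.Nonempty := ⟨b 0, 0, h0, rfl⟩
    have hbdd : BddAbove A := by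
      refine ⟨μ * b 0, ?_⟩
      rintro _ ⟨z, hz, rfl⟩
      exact cross z 0 hz h0
    have hle : ∀ z : Vec n, supp z ⊆ F → b z ≤ sSup A := fun z hz =>
      le_csSup hbdd ⟨z, hz, rfl⟩
    have hge : ∀ z : Vec n, supp z ⊆ F → sSup A ≤ μ * b z := fun z hz => by
      refine csSup_le hne ?_
      rintro _ ⟨z', hz', rfl⟩
      exact cross z' z hz' hz
    refine ⟨sSup A, (hbε 0).trans (hle 0 h0), fun u v hu hv => ?_⟩
    have h := hb v hv (u - v) (supp_sub_subset hu hv)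
    rw [add_sub_cancel] at h
    constructor
    · refine le_trans ?_ h.1
      gcongr
      rw [div_le_iff₀ hμ0, mul_comm]
      exact hge v hv
    · refine h.2.trans ?_
      gcongr
      exact hle v hv
  · push Not at hy
    refine ⟨ε, le_rfl, fun u v hu hv => ?_⟩
    rw [hy u hu, hy v hv]
    simp [bregman]

/-- Uniform two-sided Bregman bounds make the gradient nearly a multiple of the identity on the
subspace. -/
lemma norm_gradient_sub_le {f : Vec n → ℝ} {F : Finset (Fin n)} {m M : ℝ}
    (h : ∀ u v : Vec n, supp u ⊆ F → supp v ⊆ F →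
      m * ‖u - v‖ ^ 2 ≤ bregman f u v ∧ bregman f u v ≤ M * ‖u - v‖ ^ 2)
    {u v : Vec n} (hu : supp u ⊆ F) (hv : supp v ⊆ F) :
    ‖restrict (∇ f u - ∇ f v) F - (M + m) • (u - v)‖ ≤ (M - m) * ‖u - v‖ := by
  set d := u - v with hd
  set g := restrict (∇ f u - ∇ f v) F - (M + m) • d with hg
  have hdF : supp d ⊆ F := supp_sub_subset hu hv
  have hgF : supp g ⊆ F :=
    supp_sub_subset (supp_restrict_subset _ _) (supp_smul_subset _ hdF)
  -- The four divergences between `u`, `v` and the two points symmetric about their midpoint.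
  have key : ∀ w : Vec n, supp w ⊆ F → ⟪g, w⟫ ≤ (M - m) * (‖d‖ ^ 2 / 4 + ‖w‖ ^ 2) := by
    intro w hw
    have hq : supp ((1 / 2 : ℝ) • d) ⊆ F := supp_smul_subset _ hdF
    set e := (1 / 2 : ℝ) • d with he
    have hp : supp (v + e + w) ⊆ F := supp_add_subset (supp_add_subset hv hq) hw
    have hp' : supp (v + e - w) ⊆ F := supp_sub_subset (supp_add_subset hv hq) hw
    have huv : u = v + e + e := by
      rw [he, add_assoc, ← add_smul, hd]; norm_num
    have h1 := (h _ v hp hv).2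
    have h2 := (h _ u hp' hu).2
    have h3 := (h _ u hp hu).1
    have h4 := (h _ v hp' hv).1
    have e1 : v + e + w - v = e + w := by abel
    have e2 : v + e - w - u = -(e + w) := by rw [huv]; abel
    have e3 : v + e + w - u = -(e - w) := by rw [huv]; abel
    have e4 : v + e - w - v = e - w := by abel
    have hde : d = (2 : ℝ) • e := by rw [he, smul_smul]; norm_num
    have hgw : ⟪g, w⟫ = ⟪∇ f u, w⟫ - ⟪∇ f v, w⟫ - 2 * (M + m) * ⟪e, w⟫ := by
      rw [hg, inner_sub_left, inner_restrict_left _ hw, inner_sub_left, hde, smul_smul,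
        real_inner_smul_left]
      ring
    have hdn : ‖d‖ ^ 2 = 4 * ‖e‖ ^ 2 := by
      rw [hde, norm_smul, mul_pow]; norm_num
    rw [hgw, hdn]
    simp only [bregman, e1, e2, e3, e4, norm_neg, inner_neg_right, inner_add_right,
      inner_sub_right, norm_add_sq_real, norm_sub_sq_real] at h1 h2 h3 h4
    linarith
  by_cases hd0 : ‖d‖ = 0
  · have : u = v := by simpa [hd, sub_eq_zero] using hd0
    have hg0 : g = 0 := by
      ext i; simp [hg, hd, this]
    rw [hg0, hd0]; simp
  by_cases hg0 : ‖g‖ = 0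
  · rw [hg0]
    have := key 0 (by simp)
    simp only [inner_zero_right, norm_zero] at this
    have hd2 : 0 < ‖d‖ := lt_of_le_of_ne (norm_nonneg _) (Ne.symm hd0)
    have : 0 ≤ (M - m) * ‖d‖ ^ 2 := by linarith
    have := nonneg_of_mul_nonneg_left this (by positivity)
    positivity
  have hd2 : 0 < ‖d‖ := lt_of_le_of_ne (norm_nonneg _) (Ne.symm hd0)
  have hg2 : 0 < ‖g‖ := lt_of_le_of_ne (norm_nonneg _) (Ne.symm hg0)
  have hk := key ((‖d‖ / (2 * ‖g‖)) • g) (supp_smul_subset _ hgF)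
  rw [real_inner_smul_right, real_inner_self_eq_norm_sq, norm_smul, mul_pow, Real.norm_eq_abs,
    sq_abs] at hk
  have e1 : ‖d‖ / (2 * ‖g‖) * ‖g‖ ^ 2 = ‖g‖ * ‖d‖ / 2 := by field_simp
  have e2 : (‖d‖ / (2 * ‖g‖)) ^ 2 * ‖g‖ ^ 2 = ‖d‖ ^ 2 / 4 := by field_simp; norm_num
  rw [e1, e2] at hk
  refine le_of_mul_le_mul_right ?_ hd2
  nlinarith

/-- A minimizer over a coordinate subspace has vanishing partial gradient. -/
lemma IsArgmin.restrict_gradient_eq_zero {f : Vec n → ℝ} {Ω : Finset (Fin n)} {b : Vec n} {M : ℝ}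
    (hb : IsArgmin f Ω b)
    (hM : ∀ u v : Vec n, supp u ⊆ Ω → supp v ⊆ Ω → bregman f u v ≤ M * ‖u - v‖ ^ 2) :
    restrict (∇ f b) Ω = 0 := by
  set w := restrict (∇ f b) Ω with hw
  have hwΩ : supp w ⊆ Ω := supp_restrict_subset _ _
  have hin : ⟪∇ f b, w⟫ = ‖w‖ ^ 2 := by
    rw [← inner_restrict_left _ hwΩ, real_inner_self_eq_norm_sq]
  set t : ℝ := 1 / (|M| + 1) with ht
  have hM1 : 0 < |M| + 1 := by positivity
  have ht0 : 0 < t := by positivity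
  have hs : supp (b - t • w) ⊆ Ω := supp_sub_subset hb.1 (supp_smul_subset t hwΩ)
  have h1 := hb.2 _ hs
  have h2 := hM _ b hs hb.1
  have e : b - t • w - b = -(t • w) := by abel
  simp only [bregman, e, inner_neg_right, real_inner_smul_right, hin, norm_neg, norm_smul,
    mul_pow, Real.norm_eq_abs, sq_abs] at h2
  have h3 : t * ‖w‖ ^ 2 ≤ M * (t ^ 2 * ‖w‖ ^ 2) := by linarith
  have h4 : M * t < 1 := by
    rw [ht, mul_one_div, div_lt_one hM1]
    linarith [le_abs_self M]
  by_contra hw0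
  have : 0 < t * ‖w‖ ^ 2 := by positivity
  nlinarith

/-- Quadratic growth forces a minimizer over each coordinate subspace to exist. -/
lemma exists_isArgmin {f : Vec n → ℝ} (hf : Continuous f) {Ω : Finset (Fin n)} {m : ℝ}
    (hm : 0 < m) (h : ∀ u : Vec n, supp u ⊆ Ω → m * ‖u‖ ^ 2 ≤ bregman f u 0) :
    ∃ b, IsArgmin f Ω b := by
  have hclosed : IsClosed {z : Vec n | supp z ⊆ Ω} := by
    simp only [supp_subset_iff, Set.ofPred_forall]
    refine isClosed_iInter fun i => isClosed_iInter fun _ => ?_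
    exact isClosed_eq (by fun_prop) continuous_const
  set r := ‖∇ f (0 : Vec n)‖ / m with hr
  have hr0 : 0 ≤ r := by positivity
  have hcomp : IsCompact (Metric.closedBall (0 : Vec n) r ∩ {z : Vec n | supp z ⊆ Ω}) :=
    (isCompact_closedBall _ _).inter_right hclosed
  have h0 : (0 : Vec n) ∈ Metric.closedBall (0 : Vec n) r ∩ {z : Vec n | supp z ⊆ Ω} :=
    ⟨by simpa using hr0, by simp⟩
  obtain ⟨b, ⟨-, hbΩ⟩, hb⟩ := hcomp.exists_isMinOn ⟨0, h0⟩ hf.continuousOn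
  refine ⟨b, hbΩ, fun z hz => ?_⟩
  by_cases hzr : ‖z‖ ≤ r
  · exact hb ⟨by simpa using hzr, hz⟩
  · refine (hb h0).trans ?_
    push Not at hzr
    have h1 := h z hz
    simp only [bregman, sub_zero] at h1
    have h2 : -(‖∇ f (0 : Vec n)‖ * ‖z‖) ≤ ⟪∇ f (0 : Vec n), z⟫ :=
      (abs_le.1 (abs_real_inner_le_norm _ _)).1
    rw [hr, div_lt_iff₀ hm] at hzr
    nlinarith [norm_nonneg z]

/-! ### The estimates for one iteration -/

/-- On a coordinate subspace of admissible dimension the gradient is a multiple `c` of the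
identity, up to a Lipschitz perturbation of relative size `τ / (1 + τ)` with
`τ = (μ ^ 2 - 1) / 2`. -/
lemma exists_gradient_nearly_linear {f : Vec n → ℝ} {s : ℕ} {μ ε : ℝ} (hf : IsSRL f s μ)
    (hμ : 1 ≤ μ) (hε : 0 < ε)
    (hβ : ∀ z : Vec n, (supp z).card ≤ s → (ε : EReal) ≤ srlBeta f s z)
    {F : Finset (Fin n)} (hF : F.card ≤ s) :
    ∃ c, 2 * ε ≤ c ∧ ∀ u v : Vec n, supp u ⊆ F → supp v ⊆ F →
      (1 + (μ ^ 2 - 1) / 2) * ‖restrict (∇ f u - ∇ f v) F - c • (u - v)‖ ≤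
        (μ ^ 2 - 1) / 2 * c * ‖u - v‖ := by
  obtain ⟨β, hβε, hbd⟩ := exists_uniform_bounds hf hμ hε hβ hF
  have hμ0 : 0 < μ := by linarith
  have hβ0 : 0 < β := hε.trans_le hβε
  refine ⟨μ * β + β / μ, ?_, fun u v hu hv => ?_⟩
  · have : μ * β + β / μ - 2 * β = β * (μ - 1) ^ 2 / μ := by field_simp; ring
    have : 0 ≤ β * (μ - 1) ^ 2 / μ := by positivity
    linarith
  · have h := norm_gradient_sub_le hbd hu hv
    calc (1 + (μ ^ 2 - 1) / 2) * _
        ≤ (1 + (μ ^ 2 - 1) / 2) * ((μ * β - β / μ) * ‖u - v‖) := by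
          gcongr
          nlinarith
      _ = (μ ^ 2 - 1) / 2 * (μ * β + β / μ) * ‖u - v‖ := by
          field_simp
          ring

section Step

variable {f : Vec n → ℝ} {x u b : Vec n} {F Γ Φ Ω B : Finset (Fin n)} {c τ h : ℝ}

/-- If the gradient is nearly linear, it is `c` times the displacement from `x`, up to the
gradient at `x` and the nonlinear error. -/
lemma norm_restrict_gradient_sub_le (S : Finset (Fin n)) (hS : S ⊆ F) :
    ‖restrict (∇ f u) S - c • restrict (u - x) S‖ ≤
      ‖restrict (∇ f x) S‖ + ‖restrict (∇ f u - ∇ f x) F - c • (u - x)‖ := by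
  have e : restrict (∇ f u) S - c • restrict (u - x) S =
      restrict (∇ f x) S + restrict (restrict (∇ f u - ∇ f x) F - c • (u - x)) S := by
    rw [restrict_sub _ (c • (u - x)), restrict_restrict_of_subset _ hS, restrict_smul,
      restrict_sub (∇ f u)]
    abel
  rw [e]
  exact (norm_add_le _ _).trans (add_le_add_right (norm_restrict_le _ _) _)

/-- Head approximation of the gradient captures a fixed fraction of the part of the current error
that lives on the target support. -/
lemma head_captures (hc : 0 < c) (hq : 0 ≤ cHead) (hΓ : Γ ⊆ F) (hΦ : Φ ⊆ F)
    (hlin : ‖restrict (∇ f u - ∇ f x) F - c • (u - x)‖ ≤ τ * c * ‖u - x‖)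
    (hxΓ : ‖restrict (∇ f x) Γ‖ ≤ c * h) (hxΦ : ‖restrict (∇ f x) Φ‖ ≤ c * h)
    (hhead : cHead * ‖restrict (∇ f u) Φ‖ ≤ ‖restrict (∇ f u) Γ‖) :
    cHead * ‖restrict (u - x) Φ‖ - (1 + cHead) * (h + τ * ‖u - x‖) ≤
      ‖restrict (u - x) Γ‖ := by
  have h1 := norm_restrict_gradient_sub_le (f := f) (x := x) (u := u) (c := c) Γ hΓ
  have h2 := norm_restrict_gradient_sub_le (f := f) (x := x) (u := u) (c := c) Φ hΦ
  have h3 := (norm_sub_norm_le _ _).trans h1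
  have h4 := (norm_sub_norm_le _ _).trans ((norm_sub_rev _ _).trans_le h2)
  rw [norm_smul, Real.norm_of_nonneg hc.le] at h3 h4
  have h5 := mul_le_mul_of_nonneg_left h4 hq
  refine le_of_mul_le_mul_left ?_ hc
  have h6 : cHead * (‖restrict (∇ f x) Φ‖ + ‖restrict (∇ f u - ∇ f x) F - c • (u - x)‖) ≤
      cHead * (c * h + τ * c * ‖u - x‖) := by gcongr
  nlinarith

/-- On `Ω` the minimizer `b` deviates from `x` only by the noise `h` and by the nonlinear error, which
is proportional to the part of `x` that `Ω` misses. -/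
lemma norm_restrict_minimizer_sub_le (hc : 0 < c) (hτ : 0 ≤ τ) (hΩ : Ω ⊆ F)
    (hlin : (1 + τ) * ‖restrict (∇ f b - ∇ f x) F - c • (b - x)‖ ≤ τ * c * ‖b - x‖)
    (hxΩ : ‖restrict (∇ f x) Ω‖ ≤ 3 / 2 * (c * h))
    (hstat : restrict (∇ f b) Ω = 0) :
    ‖restrict (b - x) Ω‖ ≤ τ * ‖restrict (b - x) Ωᶜ‖ + 3 / 2 * (1 + τ) * h := by
  have h1 := norm_restrict_gradient_sub_le (f := f) (x := x) (u := b) (c := c) Ω hΩ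
  rw [hstat, zero_sub, norm_neg, norm_smul, Real.norm_of_nonneg hc.le] at h1
  have h2 := norm_le_restrict_add_compl (b - x) Ω
  have h3 : τ * c * ‖b - x‖ ≤
      τ * c * (‖restrict (b - x) Ω‖ + ‖restrict (b - x) Ωᶜ‖) := by gcongr
  have h4 : (1 + τ) * (c * ‖restrict (b - x) Ω‖) ≤ (1 + τ) * (3 / 2 * (c * h) +
      ‖restrict (∇ f b - ∇ f x) F - c • (b - x)‖) := by
    gcongr
    linarith
  refine le_of_mul_le_mul_left ?_ hc
  nlinarith

/-- The step where the factor `1 + c_T` is harmless: what tail approximation discards lies in `Ω`, so it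
is orthogonal to the error outside `Ω`. -/
lemma norm_restrict_tail_sub_sq_le (hbΩ : supp b ⊆ Ω) (hxΦ : supp x ⊆ Φ)
    (htail : ‖b - restrict b B‖ ≤ cTail * ‖b - restrict b Φ‖) :
    ‖restrict b B - x‖ ^ 2 ≤
      ‖restrict (b - x) Ωᶜ‖ ^ 2 + ((1 + cTail) * ‖restrict (b - x) Ω‖) ^ 2 := by
  have hb := supp_subset_iff.1 hbΩ
  have hx := supp_subset_iff.1 hxΦ
  have hT : 0 ≤ cTail := Real.sqrt_nonneg _
  have h1 : ‖b - restrict b Φ‖ ≤ ‖restrict (b - x) Ω‖ := by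
    have e : b - restrict b Φ = restrict (restrict (b - x) Ω) Φᶜ := by
      ext i
      by_cases hi : i ∈ Φ
      · simp [hi]
      · by_cases hi' : i ∈ Ω
        · simp [hi, hi', hx i hi]
        · simp [hi, hi', hb i hi']
    rw [e]
    exact norm_restrict_le _ _
  have h2 : restrict (restrict b B - x) Ωᶜ = restrict (b - x) Ωᶜ := by
    ext i
    by_cases hi : i ∈ Ω
    · simp [hi]
    · simp [hi, hb i hi]
  have h3 : ‖restrict (restrict b B - x) Ω‖ ≤ (1 + cTail) * ‖restrict (b - x) Ω‖ := by
    have e : restrict b B - x = (b - x) - (b - restrict b B) := by abel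
    rw [e, restrict_sub]
    calc _ ≤ ‖restrict (b - x) Ω‖ + ‖restrict (b - restrict b B) Ω‖ := norm_sub_le _ _
      _ ≤ ‖restrict (b - x) Ω‖ + cTail * ‖restrict (b - x) Ω‖ := by
          gcongr
          exact (norm_restrict_le _ _).trans (htail.trans (by gcongr))
      _ = _ := by ring
  rw [norm_sq_eq_restrict_add_compl _ Ω, h2, add_comm]
  gcongr

/-- After a step, the part of the error off the target support comes from the minimizer. -/
lemma norm_restrict_tail_sub_compl_le (hbΩ : supp b ⊆ Ω) (hxΦ : supp x ⊆ Φ) :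
    ‖restrict (restrict b B - x) Φᶜ‖ ≤ ‖restrict (b - x) Ω‖ := by
  have e : restrict (restrict b B - x) Φᶜ = restrict (restrict (b - x) Ω) (B ∩ Φᶜ) := by
    ext i
    by_cases hi : i ∈ Φ
    · simp [hi]
    · have hx := supp_subset_iff.1 hxΦ i hi
      by_cases hi' : i ∈ Ω
      · by_cases hB : i ∈ B <;> simp [hi, hi', hB, hx]
      · simp [hi, hi', hx, supp_subset_iff.1 hbΩ i hi']
  rw [e]
  exact norm_restrict_le _ _

lemma norm_restrict_compl_le_norm_tail_sub (hbΩ : supp b ⊆ Ω) :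
    ‖restrict (b - x) Ωᶜ‖ ≤ ‖restrict b B - x‖ := by
  have e : restrict (b - x) Ωᶜ = restrict (restrict b B - x) Ωᶜ := by
    ext i
    by_cases hi : i ∈ Ω
    · simp [hi]
    · simp [hi, supp_subset_iff.1 hbΩ i hi]
  rw [e]
  exact norm_restrict_le _ _

/-- Off `Ω = Γ ∪ supp u` the new error agrees with the old one, which lost its part on `Γ`. -/
lemma norm_restrict_compl_sq_le (hbΩ : supp b ⊆ Γ ∪ supp u) :
    ‖restrict (b - x) (Γ ∪ supp u)ᶜ‖ ^ 2 ≤ ‖u - x‖ ^ 2 - ‖restrict (u - x) Γ‖ ^ 2 := by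
  have e : restrict (b - x) (Γ ∪ supp u)ᶜ = restrict (u - x) (Γ ∪ supp u)ᶜ := by
    ext i
    by_cases hi : i ∈ Γ ∪ supp u
    · simp only [restrict_apply, Finset.mem_compl, hi, not_true, if_false]
    · have hu : u i = 0 := supp_subset_iff.1 Finset.subset_union_right i hi
      simp only [restrict_apply, Finset.mem_compl, hi, not_false_eq_true, if_true,
        PiLp.sub_apply, supp_subset_iff.1 hbΩ i hi, hu]
  rw [e, norm_sq_eq_restrict_add_compl (u - x) Γ, add_sub_cancel_left]
  gcongr
  exact norm_restrict_mono _ (Finset.compl_subset_compl.2 Finset.subset_union_left)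

end Step

/-! ### The constants -/

lemma cHead_sq : cHead ^ 2 = 1 / 14 := Real.sq_sqrt (by norm_num)

lemma cHead_nonneg : 0 ≤ cHead := Real.sqrt_nonneg _

lemma cHead_bounds : 267 / 1000 < cHead ∧ cHead < 2673 / 10000 := by
  have h := cHead_sq
  have h0 := cHead_nonneg
  constructor <;> nlinarith

lemma one_add_cTail_sq_le : (1 + cTail) ^ 2 ≤ 133 / 10 := by
  have h : cTail ^ 2 = 7 := Real.sq_sqrt (by norm_num)
  have h0 : 0 ≤ cTail := Real.sqrt_nonneg _
  nlinarith

section Parameters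

variable {μ : ℝ}

lemma two_add_cHead_sub_nonneg (hμ : μ ≤ 1 + √(1 / 56)) : 0 ≤ 2 + cHead - 2 * μ := by
  have h : √(1 / 56) = cHead / 2 := by
    rw [Real.sqrt_eq_iff_eq_sq (by norm_num) (by linarith [cHead_nonneg]), div_pow, cHead_sq]
    norm_num
  linarith

lemma sigma_sq (hμ1 : 1 ≤ μ) (hμ : μ ≤ 1 + √(1 / 56)) :
    sigma μ ^ 2 = μ ^ 2 - (2 + cHead - 2 * μ) ^ 2 := by
  refine Real.sq_sqrt ?_
  have := two_add_cHead_sub_nonneg hμ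
  have := cHead_bounds
  nlinarith

lemma lt_sigma (hμ1 : 1 ≤ μ) (hμ : μ ≤ 1 + √(1 / 56)) : 963 / 1000 < sigma μ := by
  have h := sigma_sq hμ1 hμ
  have h1 := two_add_cHead_sub_nonneg hμ
  have h2 := cHead_bounds
  have h0 : 0 ≤ sigma μ := Real.sqrt_nonneg _
  by_contra! hlt
  have h3 : sigma μ ^ 2 ≤ (963 / 1000) ^ 2 := by gcongr
  have h4 : (2 + cHead - 2 * μ) ^ 2 ≤ cHead ^ 2 := by gcongr; linarith
  rw [cHead_sq] at h4
  nlinarith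

lemma mu_sub_one_lt (hμ1 : 1 ≤ μ) (hμ : μ ≤ 1 + √(1 / 56)) (hσ : sigma μ < 1) :
    μ - 1 < 24 / 1000 := by
  have h := sigma_sq hμ1 hμ
  have h1 := two_add_cHead_sub_nonneg hμ
  have h2 := cHead_bounds
  have h3 := cHead_sq
  have h0 := lt_sigma hμ1 hμ
  have h4 : sigma μ ^ 2 < 1 := by nlinarith
  by_contra! hlt
  nlinarith

/-- A quadratic recursion for the error gives geometric decay at rate `σ` down to the floor
`R * h`, if the floor is a supersolution with enough room in the cross term. -/
lemma le_geometric_add_floor {σ p q R r r' h D : ℝ} (hσ : 0 ≤ σ) (hR : 0 ≤ R) (hp : 0 ≤ p)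
    (hh : 0 ≤ h) (hD : 0 ≤ D) (hr : 0 ≤ r)
    (hrec : r' ^ 2 ≤ σ ^ 2 * r ^ 2 + 2 * p * r * h + q * h ^ 2)
    (hcross : p ≤ σ * (R * (1 - σ))) (hfloor : σ ^ 2 * R ^ 2 + 2 * p * R + q ≤ R ^ 2)
    (hle : r ≤ D + R * h) : r' ≤ σ * D + R * h := by
  refine le_of_sq_le_sq ?_ (by positivity)
  have h1 : σ ^ 2 * r ^ 2 + 2 * p * r * h ≤
      σ ^ 2 * (D + R * h) ^ 2 + 2 * p * (D + R * h) * h := by gcongr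
  have h2 := mul_le_mul_of_nonneg_right hcross (mul_nonneg hD hh)
  have h3 := mul_le_mul_of_nonneg_right hfloor (sq_nonneg h)
  nlinarith

/-- `ν` in units of `1 / (2 * ε)`. -/
noncomputable def nuUnit (μ : ℝ) : ℝ := ((2 + cHead - 2 * μ) * (1 + cHead) + sigma μ) / sigma μ

lemma nu_eq (μ ε : ℝ) : nu μ ε = nuUnit μ / (2 * ε) := by
  rw [nu, nuUnit, div_div]
  ring_nf

lemma sigma_mul_nuUnit (hμ1 : 1 ≤ μ) (hμ : μ ≤ 1 + √(1 / 56)) :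
    sigma μ * nuUnit μ = (2 + cHead - 2 * μ) * (1 + cHead) + sigma μ := by
  have := lt_sigma hμ1 hμ
  rw [nuUnit]
  field_simp

lemma lt_nuUnit (hμ1 : 1 ≤ μ) (hμ : μ ≤ 1 + √(1 / 56)) (hσ : sigma μ < 1) :
    127 / 100 < nuUnit μ := by
  have h0 := lt_sigma hμ1 hμ
  have h1 := mu_sub_one_lt hμ1 hμ hσ
  have h2 := cHead_bounds
  rw [nuUnit, lt_div_iff₀ (by linarith)]
  nlinarith

lemma twelve_le_floor (hμ1 : 1 ≤ μ) (hμ : μ ≤ 1 + √(1 / 56)) (hσ : sigma μ < 1) :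
    12 ≤ nuUnit μ / (1 - sigma μ) := by
  have h0 := lt_sigma hμ1 hμ
  have h1 := lt_nuUnit hμ1 hμ hσ
  rw [le_div_iff₀ (by linarith)]
  linarith

set_option maxHeartbeats 1000000 in
/-- Bookkeeping of the constants: the four estimates for one step (`X` is the error outside `Ω`, `y`
the error of the minimizer on `Ω`, `a` the error captured by the head set) give a contraction by
`σ` above the noise floor. At `μ = 1` the leading coefficient of the recursion is exactly `σ ^ 2`,
so the terms of first order in `μ - 1` have to be tracked; the decimals are roundings of the
extreme values of the parameters in `1 ≤ μ < 1.024`. -/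
lemma contraction_of_step_estimates (hμ1 : 1 ≤ μ) (hμ : μ ≤ 1 + √(1 / 56)) (hσ : sigma μ < 1)
    {r r' X y a h D : ℝ} (hr : 0 ≤ r) (hX0 : 0 ≤ X) (hy0 : 0 ≤ y) (hh : 0 ≤ h)
    (hD : 0 ≤ D)
    (hr' : r' ^ 2 ≤ X ^ 2 + ((1 + cTail) * y) ^ 2)
    (hy : y ≤ (μ ^ 2 - 1) / 2 * X + 3 / 2 * (1 + (μ ^ 2 - 1) / 2) * h)
    (hX : X ^ 2 ≤ r ^ 2 - a ^ 2)
    (ha : cHead * (r - ((μ ^ 2 - 1) / 2 * r + 3 / 2 * (1 + (μ ^ 2 - 1) / 2) * h)) -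
      (1 + cHead) * (h + (μ ^ 2 - 1) / 2 * r) ≤ a)
    (hle : r ≤ D + nuUnit μ / (1 - sigma μ) * h) :
    r' ≤ sigma μ * D + nuUnit μ / (1 - sigma μ) * h := by
  have hσ0 := lt_sigma hμ1 hμ
  have hσ2 := sigma_sq hμ1 hμ
  have hν := lt_nuUnit hμ1 hμ hσ
  have hσν := sigma_mul_nuUnit hμ1 hμ
  have hfl := twelve_le_floor hμ1 hμ hσ
  have hδ := mu_sub_one_lt hμ1 hμ hσ
  have hA := two_add_cHead_sub_nonneg hμ
  have hqs := cHead_sq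
  obtain ⟨hq1, hq2⟩ := cHead_bounds
  have hK := one_add_cTail_sq_le
  set s := sigma μ
  set q := cHead
  set ν := nuUnit μ
  set R := ν / (1 - s) with hRdef
  have hR : R * (1 - s) = ν := by rw [hRdef]; field_simp [(by linarith : (1 - s) ≠ 0)]
  set A := 2 + q - 2 * μ with hAdef
  set τ := (μ ^ 2 - 1) / 2 with hτdef
  have hτ0 : μ - 1 ≤ τ := by rw [hτdef]; nlinarith only [sq_nonneg (μ - 1)]
  have hτ1 : τ ≤ 1012 / 1000 * (μ - 1) := by
    rw [hτdef]; nlinarith only [hμ1, hδ]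
  have hs2 : s ^ 2 = 1 + 2 * τ - A ^ 2 := by rw [hσ2, hτdef]; ring
  have hXr : X ≤ r := le_of_sq_le_sq (by linarith only [hX, sq_nonneg a]) hr
  have hτn : 0 ≤ τ := by linarith
  have hτs : τ ≤ 243 / 10000 := by linarith
  set p₀ := q - (1 + 2 * q) * τ with hp₀
  set q₀ := 1 + q + 3 / 2 * q * (1 + τ) with hq₀
  have ha' : p₀ * r - q₀ * h ≤ a := by
    have : p₀ * r - q₀ * h = q * (r - (τ * r + 3 / 2 * (1 + τ) * h)) -
        (1 + q) * (h + τ * r) := by rw [hp₀, hq₀]; ring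
    linarith
  have hAp : A ≤ p₀ := by
    have : q * τ ≤ 2673 / 10000 * τ := by gcongr
    rw [hp₀, hAdef]
    linarith only [this, hτ1, hμ1]
  have hA1 : 219 / 1000 ≤ A := by linarith
  have hpq : p₀ ≤ q := by
    have : 0 ≤ (1 + 2 * q) * τ := by positivity
    rw [hp₀]
    linarith only [this]
  have hq₀1 : 166 / 100 ≤ q₀ := by rw [hq₀]; nlinarith only [hq1, hτn]
  have hq₀2 : q₀ ≤ 168 / 100 := by rw [hq₀]; nlinarith only [hq1, hq2, hτn, hτs]
  have hyK : ((1 + cTail) * y) ^ 2 ≤ 133 / 10 * y ^ 2 := by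
    rw [mul_pow]; gcongr
  have hRh : 0 ≤ R * h := mul_nonneg (by linarith) hh
  rcases le_total (q₀ * h) (p₀ * r) with hcase | hcase
  · -- The lower bound `p₀ * r - q₀ * h` for `a` may be squared; `2 * p` and `w` are the coefficients
    -- of `r * h` and `h ^ 2` in the resulting recursion.
    have ha2 : (p₀ * r - q₀ * h) ^ 2 ≤ a ^ 2 := by
      have : 0 ≤ p₀ * r - q₀ * h := by linarith
      gcongr
    have hy' : y ≤ τ * r + 3 / 2 * (1 + τ) * h := by
      refine hy.trans ?_
      gcongr
    have hy2 : y ^ 2 ≤ (τ * r + 3 / 2 * (1 + τ) * h) ^ 2 := by gcongr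
    set p := p₀ * q₀ + 133 / 10 * (3 / 2 * τ * (1 + τ)) with hp
    set w := 133 / 10 * (9 / 4) * (1 + τ) ^ 2 - q₀ ^ 2 with hw
    have hpp : p ≤ 452 / 1000 + 207 / 10 * (μ - 1) := by
      have : p₀ * q₀ ≤ 2673 / 10000 * (168 / 100) := by
        gcongr
        linarith
      have : τ * (1 + τ) ≤ 1012 / 1000 * (μ - 1) * (10243 / 10000) := by
        gcongr
        linarith
      rw [hp]
      linarith
    have hp0 : 0 ≤ p := by
      have : 0 ≤ p₀ * q₀ := mul_nonneg (by linarith) (by linarith)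
      positivity
    have hww : w ≤ 287 / 10 := by rw [hw]; nlinarith only [hτn, hτs, hq₀1]
    refine le_geometric_add_floor (p := p) (q := w) (by linarith) (by linarith) hp0 hh hD hr
      ?_ ?_ ?_ hle
    · have hcoef : 1 - p₀ ^ 2 + 133 / 10 * τ ^ 2 ≤ s ^ 2 := by
        rw [hs2]
        have : A ^ 2 ≤ p₀ ^ 2 := by gcongr
        nlinarith only [this, hτn, hτs]
      have h1 := mul_le_mul_of_nonneg_right hcoef (sq_nonneg r)
      have h2 : r' ^ 2 ≤ r ^ 2 - (p₀ * r - q₀ * h) ^ 2 +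
          133 / 10 * (τ * r + 3 / 2 * (1 + τ) * h) ^ 2 := by linarith
      refine h2.trans ?_
      have e : r ^ 2 - (p₀ * r - q₀ * h) ^ 2 + 133 / 10 * (τ * r + 3 / 2 * (1 + τ) * h) ^ 2 =
          (1 - p₀ ^ 2 + 133 / 10 * τ ^ 2) * r ^ 2 + 2 * p * r * h + w * h ^ 2 := by
        rw [hp, hw]; ring
      rw [e]
      linarith
    · rw [hR, hσν]
      have : 0 ≤ A * (1 + q) := by positivity
      linarith only [this, hpp, hσ0, hδ]
    · -- Multiplied by `(1 - s)`, the claim bounds `w * (1 - s)`; `1 - s` is small because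
      -- `1 - s ^ 2 = A ^ 2 - 2 * τ`.
      have h1s : 1 - s ≤ 364 / 10000 - 152 / 100 * (μ - 1) := by
        have e : (1 - s) * (1 + s) = A ^ 2 - 2 * τ := by linarith
        have : A ^ 2 - 2 * τ ≤ 1 / 14 - 299 / 100 * (μ - 1) := by
          have e2 : A ^ 2 - 2 * τ = 1 / 14 - (4 * q + 2) * (μ - 1) + 3 * (μ - 1) ^ 2 := by
            rw [hAdef, hτdef, ← hqs]; ring
          rw [e2]
          nlinarith only [hq1, hμ1, hδ]
        by_contra! hlt
        nlinarith only [hlt, e, this, hσ0, hδ, hμ1]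
      have h1 : w * (1 - s) ≤ 287 / 10 * (364 / 10000 - 152 / 100 * (μ - 1)) :=
        (mul_le_mul_of_nonneg_right hww (by linarith)).trans
          (mul_le_mul_of_nonneg_left h1s (by norm_num))
      have h2 : 1603 / 1000 - 1 / 20 - 414 / 10 * (μ - 1) ≤ ν * (1 + s) - 2 * p := by
        nlinarith only [hν, hσ0, hpp]
      have h3 : 127 / 100 * (1603 / 1000 - 1 / 20 - 414 / 10 * (μ - 1)) ≤
          ν * (ν * (1 + s) - 2 * p) := by
        refine mul_le_mul hν.le h2 ?_ (by linarith)
        linarith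
      have h4 : w * (1 - s) ≤ ν * (ν * (1 + s) - 2 * p) := by linarith
      have h1s0 : 0 < 1 - s := by linarith
      have e : ν * (ν * (1 + s) - 2 * p) = (R ^ 2 * (1 - s ^ 2) - 2 * p * R) * (1 - s) := by
        rw [← hR]; ring
      rw [e] at h4
      have := le_of_mul_le_mul_right h4 h1s0
      linarith
  · -- Here the old error is itself of the order of the noise.
    have hr8 : r ≤ 77 / 10 * h := by
      have h1 : 219 / 1000 * r ≤ p₀ * r := by gcongr; linarith
      have h2 : q₀ * h ≤ 168 / 100 * h := by gcongr
      linarith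
    have hy3 : y ≤ 2 * h := by
      have h1 : τ * X ≤ 243 / 10000 * (77 / 10 * h) := by
        gcongr
        linarith
      have h2 : 3 / 2 * (1 + τ) * h ≤ 3 / 2 * (10243 / 10000) * h := by
        gcongr
        linarith
      linarith
    have h10 : r' ≤ 12 * h := by
      refine le_of_sq_le_sq ?_ (by positivity)
      have h1 : X ^ 2 ≤ (77 / 10 * h) ^ 2 := by gcongr; linarith
      have h2 : y ^ 2 ≤ (2 * h) ^ 2 := by gcongr
      linarith only [h1, h2, hr', hyK, sq_nonneg h]
    have h1 : 12 * h ≤ R * h := by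
      gcongr
    have : 0 ≤ s * D := mul_nonneg (by linarith) hD
    linarith

end Parameters

/-! ### The error and the cost of the loop -/

lemma model_mono (G : SimpleGraph (Fin n)) {k k' : ℕ} (g : ℕ) (h : k ≤ k') :
    model G k g ⊆ model G k' g :=
  fun _ hS => ⟨hS.1.trans h, hS.2⟩

/-- `μ` bounds the ratio of a supremum and an infimum over the same set, which is nonempty as soon
as there is a nonzero sparse vector. -/
lemma IsSRL.one_le {f : Vec n → ℝ} {s : ℕ} {μ ε : ℝ} (hf : IsSRL f s μ) (hε : 0 < ε)
    (hβ : ∀ z : Vec n, (supp z).card ≤ s → (ε : EReal) ≤ srlBeta f s z)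
    {v : Vec n} (hv : v ≠ 0) (hvs : (supp v).card ≤ s) : 1 ≤ μ := by
  obtain ⟨b, hb, h⟩ := hf.exists_bounds hε (z := 0) (by simp) (hβ 0 (by simp))
  have h1 := h v (by simpa using hvs)
  have hb0 : 0 < b := hε.trans_le hb
  have hv2 : 0 < ‖v‖ ^ 2 := by positivity
  have h2 : 1 * (b * ‖v‖ ^ 2) ≤ μ * (b * ‖v‖ ^ 2) := by linarith [h1.1.trans h1.2]
  exact le_of_mul_le_mul_right h2 (by positivity)

/-- One step of Graph-MP from an iterate `u`: the part `D` of the error above the noise floor shrinks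
by the factor `σ`, and the invariant, that little of the error lies off `Φ`, is kept. The invariant
is needed because head approximation competes only with members of `𝕄(k, g)`, such as `Φ`, while
`u - x` is supported on a larger set. -/
lemma step_estimates {f : Vec n → ℝ} {k : ℕ} {μ ε η : ℝ} (hfd : Differentiable ℝ f)
    (hf : IsSRL f (8 * k) μ) (hμ1 : 1 ≤ μ) (hμ : μ ≤ 1 + √(1 / 56)) (hσ : sigma μ < 1)
    (hε : 0 < ε) (hη : 0 ≤ η)
    (hβ : ∀ z : Vec n, (supp z).card ≤ 8 * k → (ε : EReal) ≤ srlBeta f (8 * k) z)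
    {G : SimpleGraph (Fin n)} {g : ℕ} {x : Vec n} {Φ : Finset (Fin n)} (hΦ : Φ ∈ model G k g)
    (hxΦ : supp x ⊆ Φ)
    (hnoise : ∀ S ∈ model G (8 * k) g, ‖restrict (∇ f x) S‖ ≤ η)
    {R : Subroutines n} (hR : R.Correct G k g f)
    {u : Vec n} (hu : ObeysModel G (5 * k) g u)
    (hinv : ‖restrict (u - x) Φᶜ‖ ≤ (μ ^ 2 - 1) / 2 * ‖u - x‖ +
      3 / 2 * (1 + (μ ^ 2 - 1) / 2) * (η / (2 * ε)))
    {D : ℝ} (hD : 0 ≤ D)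
    (hle : ‖u - x‖ ≤ D + nuUnit μ / (1 - sigma μ) * (η / (2 * ε))) :
    ObeysModel G (5 * k) g (iteration R u).val ∧
    ‖restrict ((iteration R u).val - x) Φᶜ‖ ≤ (μ ^ 2 - 1) / 2 * ‖(iteration R u).val - x‖ +
      3 / 2 * (1 + (μ ^ 2 - 1) / 2) * (η / (2 * ε)) ∧
    ‖(iteration R u).val - x‖ ≤ sigma μ * D + nuUnit μ / (1 - sigma μ) * (η / (2 * ε)) := by
  obtain ⟨S, hS, huS⟩ := hu
  set Γ := (R.head (∇ f u)).val with hΓdef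
  have hval : (iteration R u).val = restrict (R.solve (Γ ∪ supp u)).val
      (R.tail (R.solve (Γ ∪ supp u)).val).val := by
    rw [hΓdef, ← hR.grad u]; rfl
  set b := (R.solve (Γ ∪ supp u)).val with hbdef
  set B := (R.tail b).val with hBdef
  have hhead := hR.head (∇ f u)
  have htail := hR.tail b
  rw [hval]
  set F := Γ ∪ S ∪ Φ with hFdef
  have hΓF : Γ ⊆ F := Finset.subset_union_left.trans Finset.subset_union_left
  have hSF : S ⊆ F := Finset.subset_union_right.trans Finset.subset_union_left
  have hΦF : Φ ⊆ F := Finset.subset_union_right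
  have hΩF : Γ ∪ supp u ⊆ F := Finset.union_subset hΓF (huS.trans hSF)
  have hF : F.card ≤ 8 * k := by
    have h1 := Finset.card_union_le (Γ ∪ S) Φ
    have h2 := Finset.card_union_le Γ S
    have h3 := hhead.1.1
    have h4 := hS.1
    have h5 := hΦ.1
    rw [← hΓdef] at h3
    rw [hFdef]
    omega
  obtain ⟨β, hβε, hbd⟩ := exists_uniform_bounds hf hμ1 hε hβ hF
  obtain ⟨c, hcε, hlin⟩ := exists_gradient_nearly_linear hf hμ1 hε hβ hF
  have hbArg : IsArgmin f (Γ ∪ supp u) b := by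
    refine hR.solve _ (exists_isArgmin hfd.continuous (m := β / μ)
      (div_pos (hε.trans_le hβε) (by linarith)) fun v hv => ?_)
    simpa using (hbd v 0 (hv.trans hΩF) (by simp)).1
  have hstat := hbArg.restrict_gradient_eq_zero (M := μ * β) fun v w hv hw =>
    (hbd v w (hv.trans hΩF) (hw.trans hΩF)).2
  have huF : supp u ⊆ F := huS.trans hSF
  have hxF : supp x ⊆ F := hxΦ.trans hΦF
  have hbΩ : supp b ⊆ Γ ∪ supp u := hbArg.1
  have hc : 0 < c := by linarith
  set h := η / (2 * ε) with hh
  have hh0 : 0 ≤ h := by positivity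
  have hηc : η ≤ c * h := by
    rw [hh, mul_div_assoc', le_div_iff₀ (by positivity), mul_comm]
    gcongr
  set τ := (μ ^ 2 - 1) / 2 with hτ
  have hτ0 : 0 ≤ τ := by rw [hτ]; nlinarith only [hμ1]
  have hnΓ : ‖restrict (∇ f x) Γ‖ ≤ η :=
    hnoise Γ (model_mono G g (by omega) hhead.1)
  have hnΦ : ‖restrict (∇ f x) Φ‖ ≤ η := hnoise Φ (model_mono G g (by omega) hΦ)
  have hnS : ‖restrict (∇ f x) S‖ ≤ η := hnoise S (model_mono G g (by omega) hS)
  -- `Γ ∪ supp u` need not lie in a member of the model, but it is covered by two members;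
  -- `3 / 2` is a rounding of `√2`.
  have hnΩ : ‖restrict (∇ f x) (Γ ∪ supp u)‖ ≤ 3 / 2 * (c * h) := by
    have h1 : ‖restrict (∇ f x) (Γ ∪ supp u)‖ ^ 2 ≤ η ^ 2 + η ^ 2 :=
      (norm_restrict_union_sq_le _ _ _).trans (by
        gcongr
        exact (norm_restrict_mono _ huS).trans hnS)
    refine le_trans (le_of_sq_le_sq ?_ (by positivity)) (mul_le_mul_of_nonneg_left hηc (by norm_num))
    nlinarith only [h1, sq_nonneg η]
  have hlinu : ‖restrict (∇ f u - ∇ f x) F - c • (u - x)‖ ≤ τ * c * ‖u - x‖ := by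
    refine le_trans ?_ (hlin u x huF hxF)
    exact le_mul_of_one_le_left (norm_nonneg _) (by linarith)
  have hcap := head_captures hc cHead_nonneg hΓF hΦF hlinu (hnΓ.trans hηc) (hnΦ.trans hηc)
    (hhead.2 Φ hΦ)
  have hmin := norm_restrict_minimizer_sub_le hc hτ0 hΩF (hlin b x (hbΩ.trans hΩF) hxF) hnΩ hstat
  have hX := norm_restrict_compl_le_norm_tail_sub (x := x) (B := B) hbΩ
  -- `hX` turns the error off `Ω` into the new error, which re-establishes the invariant.
  refine ⟨⟨B, htail.1, supp_restrict_subset _ _⟩, ?_, ?_⟩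
  · refine (norm_restrict_tail_sub_compl_le hbΩ hxΦ).trans (hmin.trans ?_)
    gcongr
  · refine contraction_of_step_estimates hμ1 hμ hσ (norm_nonneg (u - x)) (norm_nonneg _)
      (norm_nonneg _) hh0 hD (norm_restrict_tail_sub_sq_le hbΩ hxΦ (htail.2 Φ hΦ)) hmin
      (norm_restrict_compl_sq_le hbΩ) ?_ hle
    refine le_trans ?_ hcap
    gcongr
    · exact cHead_nonneg
    · rw [← hτ]
      linarith [norm_le_restrict_add_compl (u - x) Φ]

lemma loop_succ_val (R : Subroutines n) (N : ℕ) (u : Vec n) :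
    (loop R (N + 1) u).val = (loop R N (iteration R u).val).val := rfl

lemma loop_succ_cost (R : Subroutines n) (N : ℕ) (u : Vec n) :
    (loop R (N + 1) u).cost = (iteration R u).cost + (loop R N (iteration R u).val).cost := rfl

/-- The error decays geometrically to the noise floor; `D` is the part of the error above it. -/
lemma loop_estimates {f : Vec n → ℝ} {k : ℕ} {μ ε η : ℝ} (hfd : Differentiable ℝ f)
    (hf : IsSRL f (8 * k) μ) (hμ1 : 1 ≤ μ) (hμ : μ ≤ 1 + √(1 / 56)) (hσ : sigma μ < 1)
    (hε : 0 < ε) (hη : 0 ≤ η)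
    (hβ : ∀ z : Vec n, (supp z).card ≤ 8 * k → (ε : EReal) ≤ srlBeta f (8 * k) z)
    {G : SimpleGraph (Fin n)} {g : ℕ} {x : Vec n} {Φ : Finset (Fin n)} (hΦ : Φ ∈ model G k g)
    (hxΦ : supp x ⊆ Φ)
    (hnoise : ∀ S ∈ model G (8 * k) g, ‖restrict (∇ f x) S‖ ≤ η)
    {R : Subroutines n} (hR : R.Correct G k g f) (N : ℕ) :
    ∀ {u : Vec n}, ObeysModel G (5 * k) g u →
      ‖restrict (u - x) Φᶜ‖ ≤ (μ ^ 2 - 1) / 2 * ‖u - x‖ +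
        3 / 2 * (1 + (μ ^ 2 - 1) / 2) * (η / (2 * ε)) →
      ∀ {D : ℝ}, 0 ≤ D → ‖u - x‖ ≤ D + nuUnit μ / (1 - sigma μ) * (η / (2 * ε)) →
      ObeysModel G (5 * k) g (loop R N u).val ∧
      ‖(loop R N u).val - x‖ ≤
        sigma μ ^ N * D + nuUnit μ / (1 - sigma μ) * (η / (2 * ε)) := by
  induction N with
  | zero =>
    intro u hu _ D _ hle
    have e : (loop R 0 u).val = u := rfl
    rw [e, pow_zero, one_mul]
    exact ⟨hu, hle⟩
  | succ N ih =>
    intro u hu hinv D hD hle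
    obtain ⟨h1, h2, h3⟩ :=
      step_estimates hfd hf hμ1 hμ hσ hε hη hβ hΦ hxΦ hnoise hR hu hinv hD hle
    rw [loop_succ_val, pow_succ, mul_assoc]
    exact ih h1 h2 (mul_nonneg (Real.sqrt_nonneg _) hD) h3

lemma zero_obeysModel (G : SimpleGraph (Fin n)) (k g : ℕ) :
    ObeysModel G k g (0 : Vec n) := by
  refine ⟨∅, ⟨by simp, ?_⟩, by simp⟩
  have : IsEmpty ((∅ : Finset (Fin n)) : Set (Fin n)) := by simp
  have : IsEmpty (G.induce ((∅ : Finset (Fin n)) : Set (Fin n))).ConnectedComponent :=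
    ⟨fun c => c.ind fun v => IsEmpty.false v⟩
  simp [numComponents]

/-- After the prescribed number of iterations the geometric part of the error is below `b`. -/
lemma pow_mul_le_of_numIterations_le {σ a b : ℝ} (hσ0 : 0 < σ) (hσ1 : σ < 1) (ha : 0 ≤ a)
    (hb : 0 < b) {N : ℕ} (hN : numIterations σ a b ≤ N) : σ ^ N * a ≤ b := by
  rcases ha.eq_or_lt with rfl | ha
  · simpa using hb.le
  have hl : 0 < Real.log (1 / σ) := Real.log_pos (by rw [lt_div_iff₀ hσ0]; linarith)
  have h1 : Real.log (a / b) / Real.log (1 / σ) ≤ N :=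
    (Nat.le_ceil _).trans (by exact_mod_cast (le_max_right _ _).trans hN)
  rw [div_le_iff₀ hl, ← Real.log_pow, Real.log_le_log_iff (by positivity) (by positivity),
    one_div, inv_pow, div_le_iff₀ hb, inv_mul_eq_div, le_div_iff₀ (by positivity)] at h1
  linarith

/-- The gradient and the two passes contribute `3 * C₀`, head and tail `2 * C₀`, the solver `1`. -/
lemma iteration_cost_le {f : Vec n → ℝ} {G : SimpleGraph (Fin n)} {k g : ℕ} {R : Subroutines n}
    {C₀ T : ℝ} (hR : R.Correct G k g f) (hW : R.Within G k C₀ T) (hE : 0 ≤ edgeLogCube G)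
    (hT : 0 ≤ T) (hC : 0 ≤ C₀) {u : Vec n} (hu : ObeysModel G (5 * k) g u) :
    ((iteration R u).cost : ℝ) ≤ (5 * C₀ + 1) * (T + edgeLogCube G) := by
  obtain ⟨S, hS, huS⟩ := hu
  set Γ := (R.head (R.grad u).val).val with hΓ
  set b := (R.solve (Γ ∪ supp u)).val with hb
  have hcost : (iteration R u).cost = (R.grad u).cost + ((R.head (R.grad u).val).cost +
      (n + ((R.solve (Γ ∪ supp u)).cost + ((R.tail b).cost + (n + 1))))) := rfl
  have hΩ : (Γ ∪ supp u).card ≤ 7 * k := by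
    have h1 := Finset.card_union_le Γ (supp u)
    have h2 := (hR.head (R.grad u).val).1.1
    have h3 := (Finset.card_le_card huS).trans hS.1
    rw [← hΓ] at h2
    omega
  have h1 := hW.grad u
  have h2 := hW.head (R.grad u).val
  have h3 := hW.solve _ hΩ
  have h4 := hW.tail b
  have h5 := hW.pass
  have h6 : 0 ≤ C₀ * T := mul_nonneg hC hT
  rw [hcost]
  push_cast
  linarith

lemma iteration_obeysModel {f : Vec n → ℝ} {G : SimpleGraph (Fin n)} {k g : ℕ}
    {R : Subroutines n} (hR : R.Correct G k g f) (u : Vec n) :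
    ObeysModel G (5 * k) g (iteration R u).val :=
  ⟨_, (hR.tail _).1, supp_restrict_subset _ _⟩

lemma loop_cost_le {f : Vec n → ℝ} {G : SimpleGraph (Fin n)} {k g : ℕ} {R : Subroutines n}
    {C₀ T : ℝ} (hR : R.Correct G k g f) (hW : R.Within G k C₀ T) (hE : 0 ≤ edgeLogCube G)
    (hT : 0 ≤ T) (hC : 0 ≤ C₀) (N : ℕ) : ∀ {u : Vec n}, ObeysModel G (5 * k) g u →
    ((loop R N u).cost : ℝ) ≤ N * ((5 * C₀ + 1) * (T + edgeLogCube G)) := by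
  induction N with
  | zero =>
    intro u _
    have e : (loop R 0 u).cost = 0 := rfl
    simp [e]
  | succ N ih =>
    intro u hu
    rw [loop_succ_cost]
    push_cast
    linarith [iteration_cost_le hR hW hE hT hC hu, ih (iteration_obeysModel hR u)]

lemma numIterations_le {σ : ℝ} (hσ0 : 0 < σ) (hσ1 : σ < 1) (a b : ℝ) :
    (numIterations σ a b : ℝ) ≤
      (1 + 1 / Real.log (1 / σ)) * max 1 (Real.log (a / b)) := by
  have hl : 0 < Real.log (1 / σ) := Real.log_pos (by rw [lt_div_iff₀ hσ0]; linarith)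
  set L := max 1 (Real.log (a / b)) with hL
  have hL1 : 1 ≤ L := le_max_left _ _
  have h1 : Real.log (a / b) / Real.log (1 / σ) ≤ L / Real.log (1 / σ) := by
    gcongr
    exact le_max_right _ _
  have h2 : (⌈Real.log (a / b) / Real.log (1 / σ)⌉₊ : ℝ) ≤ L / Real.log (1 / σ) + 1 :=
    (Nat.cast_le.2 (Nat.ceil_mono h1)).trans (Nat.ceil_lt_add_one (by positivity)).le
  have e : (1 + 1 / Real.log (1 / σ)) * L = L / Real.log (1 / σ) + L := by ring
  have h3 : 0 ≤ L / Real.log (1 / σ) := by positivity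
  rw [numIterations, e]
  push_cast
  exact max_le (by linarith) (by linarith)

end GraphMP

open GraphMP

theorem mainTheorem5 (μ C₀ : ℝ) (hμ : μ ≤ 1 + √(1 / 56)) (hσ : GraphMP.sigma μ < 1) :
    ∃ C : ℝ, 0 < C ∧
      ∀ (n : ℕ) (G : SimpleGraph (Fin n)) (k g : ℕ) (f : GraphMP.Vec n → ℝ) (ε : ℝ)
        (x : GraphMP.Vec n) (I : Finset (Fin n)) (R : GraphMP.Subroutines n) (N₀ : ℕ),
        Differentiable ℝ f →
        GraphMP.IsSRL f (8 * k) μ →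
        0 < ε →
        (∀ z : GraphMP.Vec n, (GraphMP.supp z).card ≤ 8 * k →
          (ε : EReal) ≤ GraphMP.srlBeta f (8 * k) z) →
        GraphMP.ObeysModel G k g x →
        GraphMP.IsArgmaxOver G (8 * k) g (∇ f x) I →
        0 < ‖GraphMP.restrict (∇ f x) I‖ →
        R.Correct G k g f →
        N₀ = GraphMP.numIterations (GraphMP.sigma μ) ‖x‖ ‖GraphMP.restrict (∇ f x) I‖ →
        (∀ N : ℕ, N₀ ≤ N →
          GraphMP.ObeysModel G (5 * k) g (GraphMP.graphMP R N).val ∧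
          ‖x - (GraphMP.graphMP R N).val‖ ≤
            (1 + GraphMP.nu μ ε / (1 - GraphMP.sigma μ)) * ‖GraphMP.restrict (∇ f x) I‖) ∧
        (∀ T : ℝ, R.Within G k C₀ T →
          ((GraphMP.graphMP R N₀).cost : ℝ) ≤ C * (T + GraphMP.edgeLogCube G) *
            max 1 (Real.log (‖x‖ / ‖GraphMP.restrict (∇ f x) I‖)) ∧
          ∀ a : ℝ, T ≤ a * n → (G.edgeSet.ncard : ℝ) ≤ a * n →
            ((GraphMP.graphMP R N₀).cost : ℝ) ≤ C * a * (n * (1 + Real.log n ^ 3)) *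
              max 1 (Real.log (‖x‖ / ‖GraphMP.restrict (∇ f x) I‖))) := by
  set L := Real.log (1 / sigma μ) with hL
  refine ⟨|C₀| + (5 * |C₀| + 1) * (1 + 1 / |L|), by positivity, ?_⟩
  intro n G k g f ε x I R N₀ hfd hf hε hβ hx hI hI0 hR hN₀
  obtain ⟨Φ, hΦ, hxΦ⟩ := hx
  set η := ‖restrict (∇ f x) I‖ with hη
  have hv : restrict (∇ f x) I ≠ 0 := norm_pos_iff.1 hI0
  -- Otherwise the hypotheses on `f` would exclude every sparse direction; `∇_I f(x)` is one.
  have hμ1 : 1 ≤ μ := hf.one_le hε hβ hv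
    ((Finset.card_le_card (supp_restrict_subset _ _)).trans hI.1.1)
  have hσ0 : 0 < sigma μ := by linarith [lt_sigma hμ1 hμ]
  have hE : 0 ≤ edgeLogCube G := by
    have : 0 ≤ Real.log n := Real.log_natCast_nonneg n
    rw [edgeLogCube]
    positivity
  refine ⟨fun N hN => ?_, fun T hW => ?_⟩
  · have hval : (graphMP R N).val = (loop R N 0).val := rfl
    rw [hN₀] at hN
    have hR0 : 0 ≤ nuUnit μ / (1 - sigma μ) * (η / (2 * ε)) :=
      mul_nonneg (by linarith [twelve_le_floor hμ1 hμ hσ]) (by positivity)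
    have hτ0 : 0 ≤ (μ ^ 2 - 1) / 2 := by nlinarith only [hμ1]
    -- The error of `x⁰ = 0` lies on the target support, so the invariant holds at the start.
    have hstart : ‖restrict ((0 : Vec n) - x) Φᶜ‖ ≤ (μ ^ 2 - 1) / 2 * ‖(0 : Vec n) - x‖ +
        3 / 2 * (1 + (μ ^ 2 - 1) / 2) * (η / (2 * ε)) := by
      have e : restrict ((0 : Vec n) - x) Φᶜ = 0 := by
        ext i
        by_cases hi : i ∈ Φ
        · simp [hi]
        · simp [hi, supp_subset_iff.1 hxΦ i hi]
      rw [e, norm_zero]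
      positivity
    obtain ⟨h1, h2⟩ := loop_estimates hfd hf hμ1 hμ hσ hε hI0.le hβ hΦ hxΦ hI.2 hR N
      (zero_obeysModel G (5 * k) g) hstart (norm_nonneg x) (by simpa using hR0)
    have h3 := pow_mul_le_of_numIterations_le hσ0 hσ (norm_nonneg x) hI0 hN
    rw [hval]
    refine ⟨h1, ?_⟩
    rw [norm_sub_rev]
    have e : (1 + nu μ ε / (1 - sigma μ)) * η =
        η + nuUnit μ / (1 - sigma μ) * (η / (2 * ε)) := by
      rw [nu_eq]; ring
    rw [e]
    linarith
  · -- The signs of `T` and `C₀` follow from the costs that they bound.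
    have hT : 0 ≤ T := (Nat.cast_nonneg _).trans (hW.solve ∅ (by simp))
    have hpass := hW.pass
    have hC : 0 ≤ C₀ := by
      by_contra! h
      have := mul_nonneg_of_nonpos_of_nonpos h.le (neg_nonpos.2 (add_nonneg hT hE))
      have : (0 : ℝ) ≤ n := Nat.cast_nonneg n
      linarith
    have hL0 : 0 < L := Real.log_pos (by rw [lt_div_iff₀ hσ0]; linarith)
    set M := max 1 (Real.log (‖x‖ / η)) with hM
    have hM1 : 1 ≤ M := le_max_left _ _
    have hTE : 0 ≤ T + edgeLogCube G := add_nonneg hT hE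
    rw [abs_of_nonneg hC, abs_of_pos hL0]
    have hmain : ((graphMP R N₀).cost : ℝ) ≤
        (C₀ + (5 * C₀ + 1) * (1 + 1 / L)) * (T + edgeLogCube G) * M := by
      have hcost : (graphMP R N₀).cost = n + (loop R N₀ 0).cost := rfl
      have h1 := loop_cost_le hR hW hE hT hC N₀ (zero_obeysModel G (5 * k) g)
      have h2 : (N₀ : ℝ) ≤ (1 + 1 / L) * M := by
        rw [hN₀]
        exact numIterations_le hσ0 hσ _ _
      have h3 : (N₀ : ℝ) * ((5 * C₀ + 1) * (T + edgeLogCube G)) ≤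
          (1 + 1 / L) * M * ((5 * C₀ + 1) * (T + edgeLogCube G)) := by gcongr
      have h4 : C₀ * (T + edgeLogCube G) ≤ C₀ * (T + edgeLogCube G) * M :=
        le_mul_of_one_le_right (mul_nonneg hC hTE) hM1
      rw [hcost]
      push_cast
      linarith
    refine ⟨hmain, fun a ha hG => hmain.trans ?_⟩
    have hlog : 0 ≤ Real.log n ^ 3 := pow_nonneg (Real.log_natCast_nonneg n) 3
    have h1 : T + edgeLogCube G ≤ a * (n * (1 + Real.log n ^ 3)) := by
      have := mul_le_mul_of_nonneg_right hG hlog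
      rw [edgeLogCube]
      linarith
    rw [mul_assoc _ a]
    gcongr
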